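/- A Cantor set is a nonempty compact, perfect, totally disconnected subset of $\mathbb{R}$. A Cantor set $K\subset\mathbb{R}$ is called regular if there are pairwise disjoint nondegenerate compact intervals $I_1,\dots,I_r$ with $K\subset D:=I_1\cup\dots\cup I_r$ and $\partial I_i\subset K$ for every $i$, and a map $\psi$ of class $C^{1+\varepsilon}$ (for some $0<\varepsilon\le 1$) on a neighborhood of $D$ with $|\psi'|>1$ there, such that each $\psi(I_i)$ is the convex hull of a union of some of the intervals $I_j$, for each $i$ one has $\psi^n(K\cap I_i)=K$ for all sufficiently large $n$, and $K=\bigcap_{n\ge 0}\psi^{-n}(D)$. For $r\in\{1,2,\dots\}\cup\{\infty\}$, a pair $(K,K')$ of Cantor sets has weak stable intersection in the sense of the $C^r$ topology if there is a $C^r$-neighborhood $\mathcal{U}$ of the identity such that $f(K)\cap g(K')\neq\emptyset$ for all $C^r$ diffeomorphisms $f,g$ of $\mathbb{R}$ in $\mathcal{U}$. Here a $C^r$-neighborhood of the identity is a set containing all $C^r$ diffeomorphisms $f$ with $\sup_x|f^{(j)}(x)-\mathrm{id}^{(j)}(x)|\le\delta$ for $0\le j\le k$, for some $\delta>0$ and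 some finite $k\le r$. Let $K,K'$ be regular Cantor sets whose Hausdorff dimensions satisfy $HD(K)+HD(K')<1$. Then for all functions $f,g$ that are of class $C^1$ on a neighborhood of $K$ and of $K'$, respectively, the set $f(K)-g(K')=\{f(x)-g(y): x\in K,\ y\in K'\}$ contains no nondegenerate interval. Moreover, $(K,K')$ does not have weak stable intersection in the sense of the $C^r$ topology, for any $r\in\{1,2,\dots\}\cup\{\infty\}$. -/

import Mathlib

open Set MeasureTheory
open scoped Pointwise NNReal ENNReal Manifold ContDiff

/-- A Cantor set of real numbers: a nonempty compact perfect totally disconnected set. -/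
structure IsCantorSet (K : Set ℝ) : Prop where
  nonempty : K.Nonempty
  isCompact : IsCompact K
  perfect : Perfect K
  isTotallyDisconnected : IsTotallyDisconnected K

/-- `ψ` is an expanding map of class `C^{1+ε}`, for some `ε ∈ (0, 1]`, on a neighbourhood of `D`:
it is differentiable there, with an `ε`-Hölder derivative of absolute value larger than `1`. -/
def IsExpandingNear (ψ : ℝ → ℝ) (D : Set ℝ) : Prop :=
  ∃ U : Set ℝ, IsOpen U ∧ D ⊆ U ∧ DifferentiableOn ℝ ψ U ∧
    (∃ C ε : ℝ≥0, 0 < ε ∧ ε ≤ 1 ∧ HolderOnWith C ε (deriv ψ) U) ∧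
    ∀ x ∈ U, 1 < |deriv ψ x|

/-- The Markov domain of the intervals `I i = [a i, b i]`. -/
def markovDomain {r : ℕ} (a b : Fin r → ℝ) : Set ℝ :=
  ⋃ i, Icc (a i) (b i)

/-- The set `K` is dynamically defined by the expanding map `ψ` with the Markov partition
consisting of the intervals `I i = [a i, b i]`. Only the values of `ψ` on a neighbourhood of the
Markov domain matter: in `eq_maximal`, the condition for `n` makes sense of the one for `n + 1`. -/
structure IsDynamicallyDefinedBy (K : Set ℝ) {r : ℕ} (a b : Fin r → ℝ) (ψ : ℝ → ℝ) : Prop where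
  lt : ∀ i, a i < b i
  disjoint : ∀ i j, i ≠ j → Disjoint (Icc (a i) (b i)) (Icc (a j) (b j))
  subset : K ⊆ markovDomain a b
  left_mem : ∀ i, a i ∈ K
  right_mem : ∀ i, b i ∈ K
  expanding : IsExpandingNear ψ (markovDomain a b)
  image_eq : ∀ i, ∃ J : Finset (Fin r),
    ψ '' Icc (a i) (b i) = convexHull ℝ (⋃ j ∈ J, Icc (a j) (b j))
  mixing : ∀ i, ∃ N : ℕ, ∀ n ≥ N, ψ^[n] '' (K ∩ Icc (a i) (b i)) = K
  eq_maximal : K = ⋂ n : ℕ, ψ^[n] ⁻¹' markovDomain a b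

/-- A regular (dynamically defined) Cantor set. -/
def IsRegularCantorSet (K : Set ℝ) : Prop :=
  IsCantorSet K ∧ ∃ (r : ℕ) (a b : Fin r → ℝ) (ψ : ℝ → ℝ), IsDynamicallyDefinedBy K a b ψ

/-- `f` is of class `C^1` on a neighbourhood of `K`. -/
def IsC1Near (f : ℝ → ℝ) (K : Set ℝ) : Prop :=
  ∃ U : Set ℝ, IsOpen U ∧ K ⊆ U ∧ ContDiffOn ℝ 1 f U

/-- `f` is within `δ` of the identity, uniformly on the line, together with its derivatives up to
order `k`. -/
def IsCloseToId (k : ℕ) (δ : ℝ) (f : ℝ → ℝ) : Prop :=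
  ∀ j ≤ k, ∀ x : ℝ, |iteratedDeriv j f x - iteratedDeriv j (fun y : ℝ => y) x| < δ

/-- The pair `(K, K')` has weak stable intersection in the sense of the topology `C^r`: there is a
`C^r`-neighbourhood of the identity such that `f(K)` meets `g(K')` for all `C^r` diffeomorphisms
`f`, `g` of the line in this neighbourhood. For finite `r` the choice `k = r` is the
decisive one; for `r = ∞` the basic neighbourhoods are given by all finite orders `k`. -/
def HasWeakStableIntersection (r : ℕ∞) (K K' : Set ℝ) : Prop :=
  ∃ k : ℕ, (k : ℕ∞) ≤ r ∧ ∃ δ : ℝ, 0 < δ ∧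
    ∀ f g : ℝ ≃ₘ^(r : WithTop ℕ∞)⟮𝓘(ℝ, ℝ), 𝓘(ℝ, ℝ)⟯ ℝ,
      IsCloseToId k δ f → IsCloseToId k δ g → (f '' K ∩ g '' K').Nonempty

/-!
The difference set `f(K) - g(K')` is shown to be a Lebesgue null set; it therefore contains no
interval. Weak stable intersection, tested on translations alone, would put a neighbourhood of `0`
into `K - K'`, which is the case `f = g = id`.

For the null set property, cover `K` by balls of radii `d n` with `∑ (d n) ^ t` small, where
`dimH K < t`. If `K'` needs only `O(ρ ^ (-s))` balls of radius `ρ`, with `t + s ≤ 1`, then pairing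
the `n`-th ball of the cover of `K` with the balls of radius `d n` for `K'` covers `f(K) - g(K')`
by sets of total length `O(∑ (d n) ^ (1 - s)) = O(∑ (d n) ^ t)`
(`volume_image_sub_image_eq_zero`).

The point is thus that a regular Cantor set has upper box dimension at most its Hausdorff dimension.
This holds for every compact set of which each small part can be magnified, with
uniform control, into the whole set (`HasMagnifications.exists_card_ball_cover_le`): a single
finite cover with small `s`-dimensional sum yields a recursive inequality between the covering
numbers at different scales, under which the bound `B * ρ ^ (-s)` is preserved. For a regular Cantor
set the magnifications are iterates of the expanding map `ψ`, stopped when the image of the small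
part has reached a fixed size; bounded distortion, which rests on the Hölder continuity of `ψ'`,
makes them expand uniformly (`hasMagnifications_of_expanding`).
-/

/-! ### Covers with small Hausdorff sums -/

/-- If `dimH K < s`, then `K` has countable covers by balls of positive radii `d n` with
`∑ (d n) ^ s` as small as desired. -/
theorem exists_ball_cover_of_dimH_lt {K : Set ℝ} {s : ℝ≥0} (hs : dimH K < s) {ε : ℝ≥0∞}
    (hε : ε ≠ 0) :
    ∃ (x : ℕ → ℝ) (d : ℕ → ℝ), (∀ n, 0 < d n) ∧ K ⊆ ⋃ n, Metric.ball (x n) (d n) ∧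
      ∑' n, ENNReal.ofReal (d n ^ (s : ℝ)) ≤ ε := by
  have hs0 : (0 : ℝ) < s := by
    have : (0 : ℝ≥0∞) < s := lt_of_le_of_lt bot_le hs
    exact_mod_cast this
  have h0 : μH[(s : ℝ)] K = 0 := hausdorffMeasure_of_dimH_lt hs
  have hε2 : ε / 2 ≠ 0 := by simpa using hε
  rw [Measure.hausdorffMeasure_apply] at h0
  have h1 : (⨅ (t : ℕ → Set ℝ) (_ : K ⊆ ⋃ n, t n) (_ : ∀ n, Metric.ediam (t n) ≤ 1),
      ∑' n, ⨆ _ : (t n).Nonempty, Metric.ediam (t n) ^ (s : ℝ)) < ε / 2 := by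
    refine lt_of_le_of_lt ?_ (pos_iff_ne_zero.2 hε2)
    rw [← h0]
    exact le_iSup₂ (f := fun (r : ℝ≥0∞) (_ : 0 < r) =>
      ⨅ (t : ℕ → Set ℝ) (_ : K ⊆ ⋃ n, t n) (_ : ∀ n, Metric.ediam (t n) ≤ r),
          ∑' n, ⨆ _ : (t n).Nonempty, Metric.ediam (t n) ^ (s : ℝ)) 1 one_pos
  simp only [iInf_lt_iff] at h1
  obtain ⟨t, hKt, ht1, hsum⟩ := h1
  obtain ⟨e, he0, hesum⟩ := ENNReal.exists_pos_sum_of_countable hε2 ℕ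
  -- Diameters may vanish, so each one is replaced by a slightly larger positive radius.
  have key : ∀ n, ∃ p : ℝ × ℝ, 0 < p.2 ∧ t n ⊆ Metric.ball p.1 p.2 ∧
      ENNReal.ofReal (p.2 ^ (s : ℝ)) ≤
        (⨆ _ : (t n).Nonempty, Metric.ediam (t n) ^ (s : ℝ)) + e n := by
    intro n
    have hcont : ∀ a : ℝ, 0 ≤ a → ∃ d, a < d ∧ d ^ (s : ℝ) < a ^ (s : ℝ) + e n := by
      intro a _
      have hc : ContinuousAt (fun d : ℝ => d ^ (s : ℝ)) a :=
        Real.continuousAt_rpow_const _ _ (Or.inr hs0.le)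
      have hlt : a ^ (s : ℝ) < a ^ (s : ℝ) + e n :=
        lt_add_of_pos_right _ (NNReal.coe_pos.2 (he0 n))
      have hev := (hc.eventually (gt_mem_nhds hlt)).filter_mono
        (nhdsWithin_le_nhds (s := Ioi a))
      obtain ⟨d, hd, hd'⟩ := (hev.and self_mem_nhdsWithin).exists
      exact ⟨d, hd', hd⟩
    rcases (t n).eq_empty_or_nonempty with hn | ⟨x, hx⟩
    · obtain ⟨d, hd, hd'⟩ := hcont 0 le_rfl
      refine ⟨(0, d), hd, by simp [hn], ?_⟩
      rw [Real.zero_rpow hs0.ne', zero_add] at hd'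
      refine le_trans ?_ le_add_self
      rw [← ENNReal.ofReal_coe_nnreal]
      exact ENNReal.ofReal_le_ofReal hd'.le
    · have hfin : Metric.ediam (t n) ≠ ⊤ := ne_top_of_le_ne_top ENNReal.one_ne_top (ht1 n)
      obtain ⟨d, hd, hd'⟩ := hcont (Metric.ediam (t n)).toReal ENNReal.toReal_nonneg
      have hd0 : 0 < d := lt_of_le_of_lt ENNReal.toReal_nonneg hd
      refine ⟨(x, d), hd0, fun y hy => ?_, ?_⟩
      · refine Metric.mem_ball.2 (lt_of_le_of_lt ?_ hd)
        rw [dist_edist]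
        exact ENNReal.toReal_mono hfin (Metric.edist_le_ediam_of_mem hy hx)
      · rw [iSup_pos ⟨x, hx⟩]
        refine (ENNReal.ofReal_le_ofReal hd'.le).trans ?_
        rw [ENNReal.ofReal_add (by positivity) (NNReal.coe_nonneg _), ENNReal.ofReal_coe_nnreal,
          ← ENNReal.ofReal_rpow_of_nonneg ENNReal.toReal_nonneg hs0.le, ENNReal.ofReal_toReal hfin]
  choose p hp0 hpt hps using key
  refine ⟨fun n => (p n).1, fun n => (p n).2, hp0, hKt.trans (iUnion_mono hpt), ?_⟩
  calc ∑' n, ENNReal.ofReal ((p n).2 ^ (s : ℝ))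
      ≤ ∑' n, ((⨆ _ : (t n).Nonempty, Metric.ediam (t n) ^ (s : ℝ)) + e n) :=
        ENNReal.tsum_le_tsum hps
    _ = (∑' n, ⨆ _ : (t n).Nonempty, Metric.ediam (t n) ^ (s : ℝ)) + ∑' n, (e n : ℝ≥0∞) :=
        ENNReal.tsum_add
    _ ≤ ε / 2 + ε / 2 := add_le_add hsum.le hesum.le
    _ = ε := ENNReal.add_halves ε

/-! ### Box counting for sets with magnifications -/

/-- Every part `V` of `K`, of diameter at most `d`, can be magnified into `K`: some map `V → K`
expands all distances by a factor of at least `1 / (A * d)`, that is, up to the constant `A`, to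
unit size. -/
def HasMagnifications (A : ℝ) (K : Set ℝ) : Prop :=
  ∀ V ⊆ K, ∀ d : ℝ, (∀ x ∈ V, ∀ y ∈ V, |x - y| ≤ d) →
    ∃ φ : ℝ → ℝ, MapsTo φ V K ∧ ∀ x ∈ V, ∀ y ∈ V, |x - y| ≤ A * d * |φ x - φ y|

/-- A cover by balls pulls back along an expanding map, without more balls being needed. -/
theorem exists_ball_cover_of_expanding {K V : Set ℝ} {φ : ℝ → ℝ} {c ρ : ℝ} (hc : 0 ≤ c)
    (hφ : MapsTo φ V K) (hexp : ∀ x ∈ V, ∀ y ∈ V, |x - y| ≤ c * |φ x - φ y|) {T : Finset ℝ}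
    (hT : K ⊆ ⋃ t ∈ T, Metric.closedBall t ρ) :
    ∃ T' : Finset ℝ, T'.card ≤ T.card ∧ V ⊆ ⋃ t ∈ T', Metric.closedBall t (2 * c * ρ) := by
  classical
  refine ⟨T.image fun t => if h : ∃ v ∈ V, φ v ∈ Metric.closedBall t ρ then h.choose else 0,
    Finset.card_image_le, fun x hx => ?_⟩
  obtain ⟨t, ht, hxt⟩ := mem_iUnion₂.1 (hT (hφ hx))
  have h : ∃ v ∈ V, φ v ∈ Metric.closedBall t ρ := ⟨x, hx, hxt⟩
  refine mem_iUnion₂.2 ⟨h.choose, Finset.mem_image.2 ⟨t, ht, by rw [dif_pos h]⟩, ?_⟩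
  obtain ⟨hv, hvt⟩ := h.choose_spec
  rw [Metric.mem_closedBall, Real.dist_eq]
  have h1 : |φ x - φ h.choose| ≤ 2 * ρ := by
    have := dist_triangle_right (φ x) (φ h.choose) t
    rw [Metric.mem_closedBall] at hxt hvt
    rw [← Real.dist_eq]
    linarith
  calc |x - h.choose| ≤ c * |φ x - φ h.choose| := hexp x hx _ hv
    _ ≤ c * (2 * ρ) := by gcongr
    _ = 2 * c * ρ := by ring

/-- For a compact set with magnifications, the upper box dimension is at most the Hausdorff
dimension. A finite cover of `K` by balls of radii `d j` with `∑ (4 * A * d j) ^ s ≤ 1` bounds the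
number of balls of radius `ρ` needed for `K` by the sum of the numbers of balls of the larger
radii `ρ / (4 * A * d j)`, and the bound `B * ρ ^ (-s)` reproduces itself under this recursion. -/
theorem HasMagnifications.exists_card_ball_cover_le {K : Set ℝ} (hK : IsCompact K) {A : ℝ}
    (hA : 0 < A) (h : HasMagnifications A K) {s : ℝ≥0} (hs : dimH K < s) :
    ∃ B : ℝ, 0 ≤ B ∧ ∀ ρ : ℝ, 0 < ρ → ρ ≤ 1 →
      ∃ T : Finset ℝ, (T.card : ℝ) ≤ B * ρ ^ (-(s : ℝ)) ∧
        K ⊆ ⋃ t ∈ T, Metric.closedBall t ρ := by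
  classical
  have hs0 : (0 : ℝ) < s := by
    have : (0 : ℝ≥0∞) < s := lt_of_le_of_lt bot_le hs
    exact_mod_cast this
  have hA8 : (0 : ℝ) < (1 / (8 * A)) ^ (s : ℝ) := by positivity
  -- This bound on the sum gives both `∑ (4 * A * d j) ^ s ≤ 1` and `4 * A * d j ≤ 1 / 2`; by the
  -- latter the radii at least double in the recursion, which makes it an induction.
  obtain ⟨x, d, hd0, hcov, hsum⟩ :=
    exists_ball_cover_of_dimH_lt hs (ε := ENNReal.ofReal ((1 / (8 * A)) ^ (s : ℝ)))
      (ENNReal.ofReal_pos.2 hA8).ne'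
  obtain ⟨J, hJ⟩ := hK.elim_finite_subcover _ (fun n => Metric.isOpen_ball) hcov
  have hsumJ : ∑ j ∈ J, d j ^ (s : ℝ) ≤ (1 / (8 * A)) ^ (s : ℝ) := by
    rw [← ENNReal.ofReal_le_ofReal_iff hA8.le, ENNReal.ofReal_sum_of_nonneg]
    · exact (ENNReal.sum_le_tsum J).trans hsum
    · intro j _
      have := hd0 j
      positivity
  have hd8 : ∀ j ∈ J, 4 * A * d j ≤ 1 / 2 := by
    intro j hj
    have h1 : d j ^ (s : ℝ) ≤ (1 / (8 * A)) ^ (s : ℝ) :=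
      (Finset.single_le_sum (f := fun j => d j ^ (s : ℝ))
        (fun i _ => by have := hd0 i; positivity) hj).trans hsumJ
    rw [Real.rpow_le_rpow_iff (hd0 j).le (by positivity) hs0, le_div_iff₀ (by positivity)] at h1
    linarith
  have hsum1 : ∑ j ∈ J, (4 * A * d j) ^ (s : ℝ) ≤ 1 := by
    have h1 : ∀ j ∈ J, (4 * A * d j) ^ (s : ℝ) = (4 * A) ^ (s : ℝ) * d j ^ (s : ℝ) :=
      fun j _ => Real.mul_rpow (by positivity) (hd0 j).le
    rw [Finset.sum_congr rfl h1, ← Finset.mul_sum]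
    calc (4 * A) ^ (s : ℝ) * ∑ j ∈ J, d j ^ (s : ℝ)
        ≤ (4 * A) ^ (s : ℝ) * (1 / (8 * A)) ^ (s : ℝ) := by gcongr
      _ = (1 / 2) ^ (s : ℝ) := by
          rw [← Real.mul_rpow (by positivity) (by positivity)]
          congr 1
          field_simp
          norm_num
      _ ≤ 1 := Real.rpow_le_one (by norm_num) (by norm_num) hs0.le
  -- For `ρ ≤ r` the radii `ρ / (4 * A * d j)` are at most `1`, as the inductive bound requires.
  obtain ⟨r, hr0, hr⟩ : ∃ r > 0, ∀ j ∈ J, r ≤ 4 * A * d j := by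
    have hev : ∀ᶠ r in nhdsWithin (0 : ℝ) (Ioi 0), ∀ j ∈ J, r ≤ 4 * A * d j := by
      rw [Finset.eventually_all]
      intro j _
      have : (0 : ℝ) < 4 * A * d j := by have := hd0 j; positivity
      exact ((gt_mem_nhds this).filter_mono nhdsWithin_le_nhds).mono fun _ h => le_of_lt h
    obtain ⟨r, hr, hr'⟩ := (hev.and self_mem_nhdsWithin).exists
    exact ⟨r, hr', hr⟩
  obtain ⟨T₀, -, hT₀f, hT₀⟩ := hK.finite_cover_balls hr0
  set B : ℝ := (hT₀f.toFinset.card : ℝ)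
  have hB0 : 0 ≤ B := Nat.cast_nonneg _
  refine ⟨B, hB0, ?_⟩
  have hbase : ∀ ρ, r ≤ ρ → ρ ≤ 1 → ∃ T : Finset ℝ, (T.card : ℝ) ≤ B * ρ ^ (-(s : ℝ)) ∧
      K ⊆ ⋃ t ∈ T, Metric.closedBall t ρ := by
    intro ρ hρ hρ1
    refine ⟨hT₀f.toFinset, ?_, fun y hy => ?_⟩
    · have : 1 ≤ ρ ^ (-(s : ℝ)) :=
        Real.one_le_rpow_of_pos_of_le_one_of_nonpos (hr0.trans_le hρ) hρ1 (by linarith)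
      exact le_mul_of_one_le_right (by positivity) this
    · obtain ⟨t, ht, hyt⟩ := mem_iUnion₂.1 (hT₀ hy)
      exact mem_iUnion₂.2 ⟨t, hT₀f.mem_toFinset.2 ht,
        Metric.closedBall_subset_closedBall hρ (Metric.ball_subset_closedBall hyt)⟩
  have hind : ∀ n : ℕ, ∀ ρ, r * (1 / 2) ^ n ≤ ρ → ρ ≤ 1 →
      ∃ T : Finset ℝ, (T.card : ℝ) ≤ B * ρ ^ (-(s : ℝ)) ∧
        K ⊆ ⋃ t ∈ T, Metric.closedBall t ρ := by
    intro n
    induction n with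
    | zero => simpa using hbase
    | succ n ih =>
      intro ρ hρ hρ1
      rcases le_total r ρ with hrρ | hrρ
      · exact hbase ρ hrρ hρ1
      have hρ0 : 0 < ρ := lt_of_lt_of_le (by positivity) hρ
      have hloc : ∀ j : ℕ, ∃ T : Finset ℝ, j ∈ J →
          (T.card : ℝ) ≤ B * (ρ / (4 * A * d j)) ^ (-(s : ℝ)) ∧
          K ∩ Metric.ball (x j) (d j) ⊆ ⋃ t ∈ T, Metric.closedBall t ρ := by
        intro j
        by_cases hj : j ∈ J
        swap
        · exact ⟨∅, fun h => absurd h hj⟩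
        have hdj := hd0 j
        have hpos : 0 < 4 * A * d j := by positivity
        obtain ⟨T, hTc, hT⟩ := ih (ρ / (4 * A * d j))
          (by
            rw [le_div_iff₀ hpos]
            calc r * (1 / 2) ^ n * (4 * A * d j) ≤ r * (1 / 2) ^ n * (1 / 2) :=
                  mul_le_mul_of_nonneg_left (hd8 j hj) (by positivity)
              _ = r * (1 / 2) ^ (n + 1) := by ring
              _ ≤ ρ := hρ)
          (by
            rw [div_le_one hpos]
            exact hrρ.trans (hr j hj))
        obtain ⟨φ, hφ, hexp⟩ := h (K ∩ Metric.ball (x j) (d j)) inter_subset_left (2 * d j) (by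
          intro y hy z hz
          have := dist_triangle_right y z (x j)
          have h1 := Metric.mem_ball.1 hy.2
          have h2 := Metric.mem_ball.1 hz.2
          rw [← Real.dist_eq]
          linarith)
        obtain ⟨T', hT'c, hT'⟩ := exists_ball_cover_of_expanding (by positivity) hφ hexp hT
        refine ⟨T', fun _ => ⟨le_trans (by exact_mod_cast hT'c) hTc, ?_⟩⟩
        have : 2 * (A * (2 * d j)) * (ρ / (4 * A * d j)) = ρ := by
          field_simp
          norm_num
        rwa [this] at hT'
      choose T hT using hloc
      refine ⟨J.biUnion T, ?_, fun y hy => ?_⟩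
      · calc ((J.biUnion T).card : ℝ) ≤ ∑ j ∈ J, ((T j).card : ℝ) := by
              exact_mod_cast Finset.card_biUnion_le
          _ ≤ ∑ j ∈ J, B * ρ ^ (-(s : ℝ)) * (4 * A * d j) ^ (s : ℝ) := by
              refine Finset.sum_le_sum fun j hj => ((hT j hj).1).trans_eq ?_
              have hpos : 0 < 4 * A * d j := by have := hd0 j; positivity
              rw [Real.div_rpow hρ0.le hpos.le, Real.rpow_neg hpos.le, div_inv_eq_mul]
              exact (mul_assoc _ _ _).symm
          _ = B * ρ ^ (-(s : ℝ)) * ∑ j ∈ J, (4 * A * d j) ^ (s : ℝ) := by rw [Finset.mul_sum]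
          _ ≤ B * ρ ^ (-(s : ℝ)) := mul_le_of_le_one_right (by positivity) hsum1
      · obtain ⟨j, hj, hyj⟩ := mem_iUnion₂.1 (hJ hy)
        obtain ⟨t, ht, hyt⟩ := mem_iUnion₂.1 ((hT j hj).2 ⟨hy, hyj⟩)
        exact mem_iUnion₂.2 ⟨t, Finset.mem_biUnion.2 ⟨j, hj, ht⟩, hyt⟩
  intro ρ hρ0 hρ1
  obtain ⟨n, hn⟩ := exists_pow_lt_of_lt_one (div_pos hρ0 hr0) (by norm_num : (1 / 2 : ℝ) < 1)
  refine hind n ρ ?_ hρ1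
  rw [lt_div_iff₀ hr0] at hn
  linarith

/-! ### Bounded distortion -/

/-- Along an expanding map `ψ` of `K` with Hölder derivative, every part of `K` that stays small
until time `n` and is large at time `n` is magnified by the `n`-th iterate of `ψ`. The logarithms
of the derivatives at corresponding times differ by terms of a geometric series, so the factors by
which any two pairs of points of this part are moved apart are comparable. -/
theorem hasMagnifications_of_expanding {K D : Set ℝ} {ψ ψ' : ℝ → ℝ} {η l C ε M : ℝ}
    (hψ : MapsTo ψ K K) (hη : 0 < η) (hl : 1 < l) (hC : 0 ≤ C) (hε : 0 < ε) (hM : 0 ≤ M)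
    (hKM : ∀ x ∈ K, ∀ y ∈ K, |x - y| ≤ M)
    (hmvt : ∀ x ∈ K, ∀ y ∈ K, |x - y| < η →
      ∃ ξ ∈ D, ξ ∈ uIcc x y ∧ |ψ x - ψ y| = |ψ' ξ| * |x - y|)
    (hexp : ∀ ξ ∈ D, l ≤ |ψ' ξ|)
    (hholder : ∀ ξ ∈ D, ∀ ζ ∈ D, |ψ' ξ - ψ' ζ| ≤ C * |ξ - ζ| ^ ε) :
    ∃ A > 0, HasMagnifications A K := by
  have hl0 : 0 < l := one_pos.trans hl
  set q : ℝ := (l ^ ε)⁻¹ with hq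
  have hq0 : 0 < q := by positivity
  have hq1 : q < 1 := inv_lt_one_of_one_lt₀ (Real.one_lt_rpow hl hε)
  have hsummable : Summable fun k : ℕ => q ^ (k + 1) :=
    (summable_nat_add_iff 1).2 (summable_geometric_of_lt_one hq0.le hq1)
  set S : ℝ := C * M ^ ε * ∑' k : ℕ, q ^ (k + 1)
  refine ⟨Real.exp S / η, by positivity, fun V hVK d hd => ?_⟩
  -- A single point never becomes large, but any map magnifies it.
  rcases V.subsingleton_or_nontrivial with hV | ⟨x₀, hx₀, y₀, hy₀, hxy₀⟩
  · refine ⟨id, hVK, fun x hx y hy => ?_⟩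
    simp [hV hx hy]
  have hit : ∀ k : ℕ, ∀ x ∈ V, ψ^[k] x ∈ K := fun k x hx => hψ.iterate k (hVK hx)
  have hgrow : ∀ n : ℕ, (∀ k < n, ∀ x ∈ V, ∀ y ∈ V, |ψ^[k] x - ψ^[k] y| < η) →
      ∀ x ∈ V, ∀ y ∈ V, ∀ j k, k + j ≤ n →
        l ^ j * |ψ^[k] x - ψ^[k] y| ≤ |ψ^[k + j] x - ψ^[k + j] y| := by
    intro n hn x hx y hy j
    induction j with
    | zero => simp
    | succ j ih =>
      intro k hk
      obtain ⟨ξ, hξD, -, hξ⟩ := hmvt _ (hit (k + j) x hx) _ (hit (k + j) y hy)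
        (hn (k + j) (by omega) x hx y hy)
      rw [← add_assoc, Function.iterate_succ_apply', Function.iterate_succ_apply', hξ]
      calc l ^ (j + 1) * |ψ^[k] x - ψ^[k] y| = l * (l ^ j * |ψ^[k] x - ψ^[k] y|) := by ring
        _ ≤ |ψ' ξ| * |ψ^[k + j] x - ψ^[k + j] y| := by
          gcongr
          · exact hexp ξ hξD
          · exact ih k (by omega)
  have hex : ∃ n : ℕ, ∃ p ∈ V, ∃ z ∈ V, η ≤ |ψ^[n] p - ψ^[n] z| := by
    by_contra! hno
    have hpos : 0 < |x₀ - y₀| := abs_pos.2 (sub_ne_zero.2 hxy₀)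
    obtain ⟨n, hn⟩ := pow_unbounded_of_one_lt (M / |x₀ - y₀|) hl
    have h1 := hgrow n (fun k _ => hno k) x₀ hx₀ y₀ hy₀ n 0 (by omega)
    rw [div_lt_iff₀ hpos] at hn
    have h2 := hKM _ (hit (0 + n) x₀ hx₀) _ (hit (0 + n) y₀ hy₀)
    simp only [Function.iterate_zero, id] at h1
    linarith
  classical
  -- The magnification is `ψ^[n]` for the first time `n` at which some pair `p`, `z` of points of
  -- `V` is at distance at least `η`; all other pairs are compared with this one.
  obtain ⟨p, hp, z, hz, hpz⟩ := Nat.find_spec hex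
  have hmin : ∀ k < Nat.find hex, ∀ x ∈ V, ∀ y ∈ V, |ψ^[k] x - ψ^[k] y| < η := by
    intro k hk x hx y hy
    by_contra! hcon
    exact Nat.find_min hex hk ⟨x, hx, y, hy, hcon⟩
  generalize Nat.find hex = n at hpz hmin
  have hsmall : ∀ k ≤ n, ∀ x ∈ V, ∀ y ∈ V, |ψ^[k] x - ψ^[k] y| ≤ M / l ^ (n - k) := by
    intro k hk x hx y hy
    have h1 := hgrow n hmin x hx y hy (n - k) k (by omega)
    rw [le_div_iff₀ (by positivity), mul_comm]
    exact h1.trans (hKM _ (hit _ x hx) _ (hit _ y hy))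
  have hdist : ∀ x ∈ V, ∀ y ∈ V, ∀ m ≤ n, |ψ^[m] p - ψ^[m] z| * |x - y| ≤
      Real.exp (∑ k ∈ Finset.range m, C * M ^ ε * q ^ (n - k)) *
        (|ψ^[m] x - ψ^[m] y| * |p - z|) := by
    intro x hx y hy m
    induction m with
    | zero => simp [mul_comm]
    | succ m ih =>
      intro hm
      obtain ⟨ξ, hξD, hξ, hξe⟩ := hmvt _ (hit m x hx) _ (hit m y hy) (hmin m (by omega) x hx y hy)
      obtain ⟨ζ, hζD, hζ, hζe⟩ := hmvt _ (hit m p hp) _ (hit m z hz) (hmin m (by omega) p hp z hz)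
      have hball : ∀ v ∈ V, ξ ∈ Metric.closedBall (ψ^[m] v) (M / l ^ (n - m)) :=
        fun v hv =>
          (convex_closedBall (ψ^[m] v) _).ordConnected.uIcc_subset
            (by rw [Metric.mem_closedBall, Real.dist_eq]; exact hsmall m (by omega) x hx v hv)
            (by rw [Metric.mem_closedBall, Real.dist_eq]; exact hsmall m (by omega) y hy v hv) hξ
      have hξζ : |ζ - ξ| ≤ M / l ^ (n - m) := by
        rw [← Real.dist_eq, ← Metric.mem_closedBall]
        exact (convex_closedBall ξ _).ordConnected.uIcc_subset
          (Metric.mem_closedBall_comm.1 (hball p hp))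
          (Metric.mem_closedBall_comm.1 (hball z hz)) hζ
      have hdiff : |ψ' ζ - ψ' ξ| ≤ C * M ^ ε * q ^ (n - m) := by
        refine (hholder ζ hζD ξ hξD).trans ?_
        have h1 : |ζ - ξ| ^ ε ≤ (M / l ^ (n - m)) ^ ε := by gcongr
        have h2 : (M / l ^ (n - m)) ^ ε = M ^ ε * q ^ (n - m) := by
          rw [Real.div_rpow hM (by positivity), hq, inv_pow, div_eq_mul_inv,
            ← Real.rpow_natCast, ← Real.rpow_natCast, ← Real.rpow_mul hl0.le,
            ← Real.rpow_mul hl0.le, mul_comm ε]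
        rw [mul_assoc, ← h2]
        gcongr
      have hratio : |ψ' ζ| ≤ Real.exp (C * M ^ ε * q ^ (n - m)) * |ψ' ξ| := by
        have h1 : 1 ≤ |ψ' ξ| := hl.le.trans (hexp ξ hξD)
        have h2 := abs_sub_abs_le_abs_sub (ψ' ζ) (ψ' ξ)
        have h3 := Real.add_one_le_exp (C * M ^ ε * q ^ (n - m))
        have h4 : 0 ≤ C * M ^ ε * q ^ (n - m) := by positivity
        calc |ψ' ζ| ≤ |ψ' ξ| + C * M ^ ε * q ^ (n - m) := by linarith
          _ ≤ (C * M ^ ε * q ^ (n - m) + 1) * |ψ' ξ| := by nlinarith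
          _ ≤ _ := by gcongr
      rw [Function.iterate_succ_apply', Function.iterate_succ_apply',
        Function.iterate_succ_apply', Function.iterate_succ_apply', hξe, hζe,
        Finset.sum_range_succ, Real.exp_add]
      calc |ψ' ζ| * |ψ^[m] p - ψ^[m] z| * |x - y|
          = |ψ' ζ| * (|ψ^[m] p - ψ^[m] z| * |x - y|) := by ring
        _ ≤ (Real.exp (C * M ^ ε * q ^ (n - m)) * |ψ' ξ|) *
            (Real.exp (∑ k ∈ Finset.range m, C * M ^ ε * q ^ (n - k)) *
              (|ψ^[m] x - ψ^[m] y| * |p - z|)) :=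
          mul_le_mul hratio (ih (by omega)) (by positivity) (by positivity)
        _ = _ := by ring
  have hS : ∑ k ∈ Finset.range n, C * M ^ ε * q ^ (n - k) ≤ S := by
    rw [← Finset.mul_sum]
    have h1 : ∑ k ∈ Finset.range n, q ^ (n - k) = ∑ k ∈ Finset.range n, q ^ (k + 1) := by
      rw [← Finset.sum_range_reflect (fun k => q ^ (k + 1)) n]
      refine Finset.sum_congr rfl fun k hk => ?_
      have := Finset.mem_range.1 hk
      congr 1
      omega
    rw [h1]
    exact mul_le_mul_of_nonneg_left
      (hsummable.sum_le_tsum _ fun k _ => by positivity) (by positivity)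
  refine ⟨ψ^[n], hit n, fun x hx y hy => ?_⟩
  have h1 : η * |x - y| ≤ Real.exp S * (|ψ^[n] x - ψ^[n] y| * d) :=
    calc η * |x - y| ≤ |ψ^[n] p - ψ^[n] z| * |x - y| := by gcongr
      _ ≤ _ := hdist x hx y hy n le_rfl
      _ ≤ Real.exp S * (|ψ^[n] x - ψ^[n] y| * d) := by
        gcongr
        exact hd p hp z hz
  rw [div_mul_eq_mul_div, div_mul_eq_mul_div, le_div_iff₀ hη]
  linarith

/-! ### Regular Cantor sets -/

theorem IsDynamicallyDefinedBy.mapsTo {K : Set ℝ} {r : ℕ} {a b : Fin r → ℝ} {ψ : ℝ → ℝ}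
    (h : IsDynamicallyDefinedBy K a b ψ) : MapsTo ψ K K := by
  intro x hx
  rw [h.eq_maximal] at hx ⊢
  refine mem_iInter.2 fun n => ?_
  have := mem_iInter.1 hx (n + 1)
  rwa [mem_preimage, Function.iterate_succ_apply] at this

/-- Points of the Markov domain that are close enough lie in the same interval of the partition. -/
theorem exists_mem_same_Icc {r : ℕ} {a b : Fin r → ℝ}
    (hab : ∀ i j, i ≠ j → Disjoint (Icc (a i) (b i)) (Icc (a j) (b j))) :
    ∃ η > 0, ∀ x ∈ markovDomain a b, ∀ y ∈ markovDomain a b, |x - y| < η →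
      ∃ i, x ∈ Icc (a i) (b i) ∧ y ∈ Icc (a i) (b i) := by
  have hcomp : IsCompact (markovDomain a b) := isCompact_iUnion fun i => isCompact_Icc
  obtain ⟨η, hη, h⟩ := lebesgue_number_lemma_of_metric hcomp
    (c := fun i => (⋃ j ∈ {j | j ≠ i}, Icc (a j) (b j))ᶜ)
    (fun i => ((Set.toFinite _).isClosed_biUnion fun j _ => isClosed_Icc).isOpen_compl)
    (fun x hx => by
      obtain ⟨i, hi⟩ := mem_iUnion.1 hx
      refine mem_iUnion.2 ⟨i, fun hmem => ?_⟩
      obtain ⟨j, hj, hxj⟩ := mem_iUnion₂.1 hmem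
      exact disjoint_left.1 (hab j i hj) hxj hi)
  refine ⟨η, hη, fun x hx y hy hxy => ?_⟩
  obtain ⟨i, hi⟩ := h x hx
  have key : ∀ w ∈ markovDomain a b, w ∈ Metric.ball x η → w ∈ Icc (a i) (b i) := by
    intro w hw hwx
    obtain ⟨j, hj⟩ := mem_iUnion.1 hw
    by_cases hji : j = i
    · rwa [← hji]
    · exact absurd (mem_iUnion₂.2 ⟨j, hji, hj⟩) (hi hwx)
  refine ⟨i, key x hx (Metric.mem_ball_self hη), key y hy ?_⟩
  rwa [Metric.mem_ball', Real.dist_eq]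

theorem exists_deriv_mul_eq_of_uIcc {ψ : ℝ → ℝ} {x y : ℝ}
    (h : ∀ w ∈ uIcc x y, DifferentiableAt ℝ ψ w) :
    ∃ ξ ∈ uIcc x y, |ψ x - ψ y| = |deriv ψ ξ| * |x - y| := by
  wlog hxy : x ≤ y generalizing x y
  · obtain ⟨ξ, hξ, he⟩ := this (uIcc_comm x y ▸ h) (le_of_not_ge hxy)
    exact ⟨ξ, uIcc_comm x y ▸ hξ, by rw [abs_sub_comm, he, abs_sub_comm y x]⟩
  rcases hxy.eq_or_lt with rfl | hlt
  · exact ⟨x, by simp, by simp⟩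
  rw [uIcc_of_le hxy] at h ⊢
  obtain ⟨ξ, hξ, he⟩ := exists_deriv_eq_slope ψ hlt
    (fun w hw => (h w hw).continuousAt.continuousWithinAt)
    (fun w hw => (h w (Ioo_subset_Icc_self hw)).differentiableWithinAt)
  refine ⟨ξ, Ioo_subset_Icc_self hξ, ?_⟩
  have hne : y - x ≠ 0 := (sub_pos.2 hlt).ne'
  rw [he, abs_sub_comm x y, ← abs_mul, div_mul_cancel₀ _ hne, abs_sub_comm]

theorem IsRegularCantorSet.exists_hasMagnifications {K : Set ℝ} (hK : IsRegularCantorSet K) :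
    ∃ A > 0, HasMagnifications A K := by
  obtain ⟨hC, r, a, b, ψ, h⟩ := hK
  obtain ⟨U, hUo, hDU, hdiff, ⟨C, ε, hε, -, hhol⟩, hder⟩ := h.expanding
  obtain ⟨η, hη, hsame⟩ := exists_mem_same_Icc h.disjoint
  have hcomp : IsCompact (markovDomain a b) := isCompact_iUnion fun i => isCompact_Icc
  obtain ⟨l, hl, hexp⟩ := hcomp.exists_forall_le' (a := (1 : ℝ))
    ((hhol.continuousOn hε).mono hDU).abs (fun x hx => hder x (hDU hx))
  refine hasMagnifications_of_expanding (D := markovDomain a b) (ψ' := deriv ψ) (C := C) (ε := ε)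
    (M := Metric.diam K) h.mapsTo hη hl C.2 hε Metric.diam_nonneg ?_ ?_ hexp ?_
  · intro x hx y hy
    exact Metric.dist_le_diam_of_mem hC.isCompact.isBounded hx hy
  · intro x hx y hy hxy
    obtain ⟨i, hxi, hyi⟩ := hsame x (h.subset hx) y (h.subset hy) hxy
    have hsub : uIcc x y ⊆ markovDomain a b :=
      (ordConnected_Icc.uIcc_subset hxi hyi).trans (subset_iUnion (fun i => Icc (a i) (b i)) i)
    obtain ⟨ξ, hξ, he⟩ := exists_deriv_mul_eq_of_uIcc (ψ := ψ) (x := x) (y := y)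
      fun w hw => hdiff.differentiableAt (hUo.mem_nhds (hDU (hsub hw)))
    exact ⟨ξ, hsub hξ, hξ, he⟩
  · intro ξ hξ ζ hζ
    exact hhol.dist_le (hDU hξ) (hDU hζ)

/-! ### Differences of images -/

theorem IsC1Near.exists_lipschitzOnWith {f : ℝ → ℝ} {K : Set ℝ} (hf : IsC1Near f K)
    (hK : IsCompact K) : ∃ L : ℝ≥0, LipschitzOnWith L f K := by
  obtain ⟨U, hU, hKU, hfU⟩ := hf
  refine LocallyLipschitzOn.exists_lipschitzOnWith_of_compact hK fun x hx => ?_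
  obtain ⟨L, t, ht, hL⟩ :=
    (hfU.contDiffAt (hU.mem_nhds (hKU hx))).exists_lipschitzOnWith
  exact ⟨L, t, mem_nhdsWithin_of_mem_nhds ht, hL⟩

/-- If `K'` is covered by at most `B * ρ ^ (-s)` balls of each radius `ρ ≤ 1`, and `dimH K < t` with
`t + s ≤ 1`, then the difference of Lipschitz images of `K` and `K'` is a null set: a ball of radius
`d` of a cover of `K` together with the balls of the same radius needed for `K'` contributes a set
of measure `O(d ^ (1 - s)) = O(d ^ t)`. -/
theorem volume_image_sub_image_eq_zero {K K' : Set ℝ} {f g : ℝ → ℝ} {L L' s t : ℝ≥0} {B : ℝ}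
    (hf : LipschitzOnWith L f K) (hg : LipschitzOnWith L' g K') (ht : dimH K < t)
    (hts : t + s ≤ 1) (hB0 : 0 ≤ B)
    (hB : ∀ ρ : ℝ, 0 < ρ → ρ ≤ 1 → ∃ T : Finset ℝ, (T.card : ℝ) ≤ B * ρ ^ (-(s : ℝ)) ∧
      K' ⊆ ⋃ y ∈ T, Metric.closedBall y ρ) :
    volume (f '' K - g '' K') = 0 := by
  have ht0 : (0 : ℝ) < t := by
    have : (0 : ℝ≥0∞) < t := lt_of_le_of_lt bot_le ht
    exact_mod_cast this
  have hts' : (t : ℝ) + s ≤ 1 := by exact_mod_cast hts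
  set c : ℝ := B * (4 * (L + L')) with hc
  have hc0 : 0 ≤ c := by positivity
  -- It suffices to bound the measure by a fixed multiple of every small `ε`.
  have key : ∀ ε : ℝ≥0, 0 < ε → ε ≤ 1 →
      volume (f '' K - g '' K') ≤ ENNReal.ofReal c * ε := by
    intro ε hε hε1
    obtain ⟨x, d, hd0, hcov, hsum⟩ :=
      exists_ball_cover_of_dimH_lt ht (ε := ε) (by simpa using hε.ne')
    have hd1 : ∀ n, d n ≤ 1 := by
      intro n
      have h1 : ENNReal.ofReal (d n ^ (t : ℝ)) ≤ 1 :=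
        (ENNReal.le_tsum n).trans (hsum.trans (by exact_mod_cast hε1))
      rw [ENNReal.ofReal_le_one] at h1
      by_contra! hcon
      exact absurd h1 (not_le.2 (Real.one_lt_rpow hcon ht0))
    choose T hTc hT using fun n => hB (d n) (hd0 n) (hd1 n)
    let E : ℕ → ℝ → Set ℝ := fun n y =>
      f '' (K ∩ Metric.ball (x n) (d n)) - g '' (K' ∩ Metric.closedBall y (d n))
    have hsub : f '' K - g '' K' ⊆ ⋃ n, ⋃ y ∈ T n, E n y := by
      rintro _ ⟨_, ⟨u, hu, rfl⟩, _, ⟨v, hv, rfl⟩, rfl⟩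
      obtain ⟨n, hn⟩ := mem_iUnion.1 (hcov hu)
      obtain ⟨y, hy, hvy⟩ := mem_iUnion₂.1 (hT n hv)
      exact mem_iUnion.2 ⟨n, mem_iUnion₂.2 ⟨y, hy, sub_mem_sub
        (mem_image_of_mem f ⟨hu, hn⟩) (mem_image_of_mem g ⟨hv, hvy⟩)⟩⟩
    have hE : ∀ n y, volume (E n y) ≤ ENNReal.ofReal (4 * (L + L') * d n) := by
      intro n y
      rcases (E n y).eq_empty_or_nonempty with he | ⟨_, _, ⟨u, hu, rfl⟩, _, ⟨v, hv, rfl⟩, rfl⟩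
      · simp [he]
      have hsubE : E n y ⊆ Metric.closedBall (f u - g v) (2 * (L + L') * d n) := by
        rintro _ ⟨_, ⟨u', hu', rfl⟩, _, ⟨v', hv', rfl⟩, rfl⟩
        have h1 := hf.dist_le_mul _ hu'.1 _ hu.1
        have h2 := hg.dist_le_mul _ hv'.1 _ hv.1
        have h3 : dist u' u ≤ 2 * d n := by
          have := dist_triangle_right u' u (x n)
          have := Metric.mem_ball.1 hu.2
          have := Metric.mem_ball.1 hu'.2
          linarith
        have h4 : dist v' v ≤ 2 * d n := by
          have := dist_triangle_right v' v y
          have := Metric.mem_closedBall.1 hv.2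
          have := Metric.mem_closedBall.1 hv'.2
          linarith
        have h5 : (L : ℝ) * dist u' u ≤ L * (2 * d n) := by gcongr
        have h6 : (L' : ℝ) * dist v' v ≤ L' * (2 * d n) := by gcongr
        refine Metric.mem_closedBall.2 ((dist_sub_sub_le _ _ _ _).trans ?_)
        linarith
      refine (measure_mono hsubE).trans ?_
      rw [Real.volume_closedBall]
      exact ENNReal.ofReal_le_ofReal (by linarith)
    have hpiece : ∀ n, volume (⋃ y ∈ T n, E n y) ≤
        ENNReal.ofReal c * ENNReal.ofReal (d n ^ (t : ℝ)) := by
      intro n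
      calc volume (⋃ y ∈ T n, E n y) ≤ ∑ y ∈ T n, volume (E n y) :=
            measure_biUnion_finset_le _ _
        _ ≤ ∑ y ∈ T n, ENNReal.ofReal (4 * (L + L') * d n) := Finset.sum_le_sum fun y _ => hE n y
        _ = ENNReal.ofReal ((T n).card * (4 * (L + L') * d n)) := by
            rw [Finset.sum_const, nsmul_eq_mul,
              ENNReal.ofReal_mul (Nat.cast_nonneg _), ENNReal.ofReal_natCast]
        _ ≤ ENNReal.ofReal (c * d n ^ (t : ℝ)) := by
            refine ENNReal.ofReal_le_ofReal ?_
            have hdn := hd0 n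
            calc ((T n).card : ℝ) * (4 * (L + L') * d n)
                ≤ B * d n ^ (-(s : ℝ)) * (4 * (L + L') * d n) := by
                  gcongr
                  exact hTc n
              _ = c * d n ^ (1 - (s : ℝ)) := by
                  rw [sub_eq_neg_add, Real.rpow_add_one hdn.ne', hc]
                  ring
              _ ≤ c * d n ^ (t : ℝ) := by
                  refine mul_le_mul_of_nonneg_left ?_ hc0
                  exact Real.rpow_le_rpow_of_exponent_ge hdn (hd1 n) (by linarith)
        _ = _ := ENNReal.ofReal_mul hc0
    calc volume (f '' K - g '' K') ≤ volume (⋃ n, ⋃ y ∈ T n, E n y) := measure_mono hsub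
      _ ≤ ∑' n, volume (⋃ y ∈ T n, E n y) := measure_iUnion_le _
      _ ≤ ∑' n, ENNReal.ofReal c * ENNReal.ofReal (d n ^ (t : ℝ)) := ENNReal.tsum_le_tsum hpiece
      _ = ENNReal.ofReal c * ∑' n, ENNReal.ofReal (d n ^ (t : ℝ)) := ENNReal.tsum_mul_left
      _ ≤ ENNReal.ofReal c * ε := by gcongr
  by_contra hne
  have hfin : ENNReal.ofReal c ≠ ⊤ := ENNReal.ofReal_ne_top
  have htend : Filter.Tendsto (fun ε : ℝ≥0 => ENNReal.ofReal c * (ε : ℝ≥0∞))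
      (nhdsWithin 0 (Ioi 0)) (nhds 0) := by
    have h1 : Filter.Tendsto (fun ε : ℝ≥0 => ENNReal.ofReal c * (ε : ℝ≥0∞)) (nhds 0)
        (nhds (ENNReal.ofReal c * ((0 : ℝ≥0) : ℝ≥0∞))) :=
      ENNReal.Tendsto.const_mul (ENNReal.continuous_coe.tendsto 0) (Or.inr hfin)
    rw [ENNReal.coe_zero, mul_zero] at h1
    exact h1.mono_left nhdsWithin_le_nhds
  refine hne (le_antisymm (ge_of_tendsto htend ?_) bot_le)
  filter_upwards [self_mem_nhdsWithin,
    nhdsWithin_le_nhds (gt_mem_nhds (zero_lt_one : (0 : ℝ≥0) < 1))] with ε h1 h2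
  exact key ε h1 (le_of_lt h2)

theorem IsRegularCantorSet.volume_image_sub_image_eq_zero {K K' : Set ℝ}
    (hK : IsRegularCantorSet K) (hK' : IsRegularCantorSet K') (hdim : dimH K + dimH K' < 1)
    {f g : ℝ → ℝ} (hf : IsC1Near f K) (hg : IsC1Near g K') :
    volume (f '' K - g '' K') = 0 := by
  obtain ⟨t, s, ht, hs, hts⟩ : ∃ t s : ℝ≥0, dimH K < t ∧ dimH K' < s ∧ t + s ≤ 1 := by
    obtain ⟨t', ht', s', hs', hts⟩ := ENNReal.exists_add_lt_of_add_lt hdim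
    have ht1 : t' ≠ ⊤ := ne_top_of_lt (lt_of_le_of_lt le_self_add hts)
    have hs1 : s' ≠ ⊤ := ne_top_of_lt (lt_of_le_of_lt le_add_self hts)
    lift t' to ℝ≥0 using ht1
    lift s' to ℝ≥0 using hs1
    exact ⟨t', s', ht', hs', by exact_mod_cast hts.le⟩
  obtain ⟨A, hA, hmag⟩ := hK'.exists_hasMagnifications
  obtain ⟨B, hB0, hB⟩ := hmag.exists_card_ball_cover_le hK'.1.isCompact hA hs
  obtain ⟨L, hL⟩ := hf.exists_lipschitzOnWith hK.1.isCompact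
  obtain ⟨L', hL'⟩ := hg.exists_lipschitzOnWith hK'.1.isCompact
  exact _root_.volume_image_sub_image_eq_zero hL hL' ht hts hB0 hB

/-! ### Translations -/

/-- The translation `x ↦ x + c` as a diffeomorphism of the line. -/
def translationDiffeomorph (n : WithTop ℕ∞) (c : ℝ) : ℝ ≃ₘ^n⟮𝓘(ℝ, ℝ), 𝓘(ℝ, ℝ)⟯ ℝ where
  toEquiv := Equiv.addRight c
  contMDiff_toFun := (contDiff_id.add contDiff_const).contMDiff
  contMDiff_invFun := (contDiff_id.add contDiff_const).contMDiff

theorem isCloseToId_add_const (k : ℕ) {c δ : ℝ} (hc : |c| < δ) :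
    IsCloseToId k δ fun x => x + c := by
  intro j _ x
  rcases j with _ | j
  · simpa using hc
  · have : deriv (fun y : ℝ => y + c) = deriv fun y : ℝ => y := by
      funext y
      simp
    rw [iteratedDeriv_succ', iteratedDeriv_succ', this, sub_self, abs_zero]
    exact (abs_nonneg c).trans_lt hc

/-- Under weak stable intersection `K` meets all small translates of `K'`, so that the difference
set is a neighbourhood of `0`. -/
theorem HasWeakStableIntersection.exists_Ioo_subset {r : ℕ∞} {K K' : Set ℝ}
    (h : HasWeakStableIntersection r K K') :
    ∃ δ > 0, Ioo (-δ) δ ⊆ (fun x => x) '' K - (fun x => x) '' K' := by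
  obtain ⟨k, -, δ, hδ, h⟩ := h
  refine ⟨δ, hδ, fun c hc => ?_⟩
  obtain ⟨_, ⟨x, hx, rfl⟩, y, hy, hxy⟩ := h (translationDiffeomorph r 0)
    (translationDiffeomorph r c) (isCloseToId_add_const k (by simpa using hδ))
    (isCloseToId_add_const k (abs_lt.2 hc))
  refine ⟨x, ⟨x, hx, rfl⟩, y, ⟨y, hy, rfl⟩, ?_⟩
  have : y + c = x + 0 := hxy
  change x - y = c
  linarith

theorem mainTheorem8 (K K' : Set ℝ) (hK : IsRegularCantorSet K) (hK' : IsRegularCantorSet K')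
    (hdim : dimH K + dimH K' < 1) :
    (∀ f g : ℝ → ℝ, IsC1Near f K → IsC1Near g K' →
      ∀ a b : ℝ, a < b → ¬ Ioo a b ⊆ f '' K - g '' K') ∧
    (∀ r : ℕ∞, 1 ≤ r → ¬ HasWeakStableIntersection r K K') := by
  have hmain : ∀ f g : ℝ → ℝ, IsC1Near f K → IsC1Near g K' →
      ∀ a b : ℝ, a < b → ¬ Ioo a b ⊆ f '' K - g '' K' := by
    intro f g hf hg a b hab hsub
    have h0 := measure_mono_null hsub (hK.volume_image_sub_image_eq_zero hK' hdim hf hg)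
    rw [Real.volume_Ioo, ENNReal.ofReal_eq_zero] at h0
    linarith
  refine ⟨hmain, fun r _ h => ?_⟩
  obtain ⟨δ, hδ, hsub⟩ := h.exists_Ioo_subset
  exact hmain _ _ ⟨univ, isOpen_univ, subset_univ _, contDiff_id.contDiffOn⟩
    ⟨univ, isOpen_univ, subset_univ _, contDiff_id.contDiffOn⟩ (-δ) δ (by linarith) hsub
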